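/- For $x,y\in\{0,1\}^n$ let $|x|$ denote the Hamming weight and $\Delta(x,y)$ the Hamming distance. For integers $n,a,b\ge 0$, $c$ and $g\ge 1$ let $\mathrm{GHD}^n_{a,b,c,g}$ be the partial function on $\{0,1\}^n\times\{0,1\}^n$ that equals $1$ if $|x|=a$, $|y|=b$ and $\Delta(x,y)\ge c+g$, equals $0$ if $|x|=a$, $|y|=b$ and $\Delta(x,y)\le c-g$, and is undefined otherwise. For a partial function $f$ let $R(f)$ be the minimum, over all two-party (two-way) communication protocols with public randomness that output the correct value with probability at least $2/3$ on every input pair on which $f$ is defined, of the worst-case number of bits exchanged. There is an absolute constant $C>0$ such that for all integers $0\le a\le b\le n/2$, all integers $c$ and all integers $g\ge 1$, $$R(\mathrm{GHD}^n_{a,b,c,g})\;\le\; C\left(\Big(\frac{a}{g}\Big)^2\Big(\log_2\frac{b}{a}+\log_2\frac{a}{g}\Big)+1\right)$$ (for $a=0$ the product on the right is read as $0$), and $$R(\mathrm{GHD}^n_{a,b,c,g})\;\le\; C\,\min\left\{\Big(\frac{c}{g}\Big)^2,\Big(\frac{n-c}{g}\Big)^2\right\}.$$ -/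

import Mathlib

open scoped ENNReal

/-- A deterministic two-party communication protocol in which Alice holds an input in `X` and Bob
an input in `Y`, with outputs in `Z`: a finite binary tree. At an `alice` node Alice sends the bit
`q x`, at a `bob` node Bob sends the bit `q y`; the protocol continues in the first subtree if the
bit is `false` and in the second one if it is `true`. A leaf carries the output. -/
inductive DetProtocol (X Y Z : Type) : Type
  | leaf (z : Z) : DetProtocol X Y Z
  | alice (q : X → Bool) (P₀ P₁ : DetProtocol X Y Z) : DetProtocol X Y Z
  | bob (q : Y → Bool) (P₀ P₁ : DetProtocol X Y Z) : DetProtocol X Y Z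

namespace DetProtocol

variable {X Y Z : Type}

/-- The output of the protocol on the input pair `(x, y)`. -/
def run : DetProtocol X Y Z → X → Y → Z
  | leaf z, _, _ => z
  | alice q P₀ P₁, x, y => if q x then P₁.run x y else P₀.run x y
  | bob q P₀ P₁, x, y => if q y then P₁.run x y else P₀.run x y

/-- The cost of a deterministic protocol: the height of the tree, that is, the largest number of
bits exchanged. -/
def depth : DetProtocol X Y Z → ℕ
  | leaf _ => 0
  | alice _ P₀ P₁ => max P₀.depth P₁.depth + 1
  | bob _ P₀ P₁ => max P₀.depth P₁.depth + 1

end DetProtocol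

/-- A randomized protocol with public randomness: a probability distribution over deterministic
protocols (the shared random string selects the deterministic protocol that is run). -/
abbrev PublicCoinProtocol (X Y Z : Type) : Type := PMF (DetProtocol X Y Z)

namespace PublicCoinProtocol

variable {X Y Z : Type}

/-- The distribution of the output of a public-coin protocol on the input pair `(x, y)`. -/
noncomputable def output (π : PublicCoinProtocol X Y Z) (x : X) (y : Y) : PMF Z :=
  PMF.map (fun P => P.run x y) π

/-- The communication cost of a public-coin protocol: the largest number of bits exchanged, in the
worst case over the public randomness. -/
noncomputable def cost (π : PublicCoinProtocol X Y Z) : ℕ∞ :=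
  ⨆ P ∈ π.support, (P.depth : ℕ∞)

/-- The protocol computes the partial function `f` (where `none` stands for "undefined"): on every
input pair on which `f` is defined the output is correct with probability at least `2/3`. -/
def Computes (π : PublicCoinProtocol X Y Z) (f : X → Y → Option Z) : Prop :=
  ∀ x y z, f x y = some z → (2 / 3 : ℝ≥0∞) ≤ π.output x y z

end PublicCoinProtocol

/-- The randomized public-coin communication complexity of a partial function: the smallest cost of
a public-coin protocol that computes it. For finite `X` and `Y` the minimum is attained, see
`randCC_attained`. -/
noncomputable def randCC {X Y Z : Type} (f : X → Y → Option Z) : ℕ :=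
  sInf {k : ℕ | ∃ π : PublicCoinProtocol X Y Z, π.Computes f ∧ π.cost ≤ (k : ℕ∞)}

/-- Every function on finite sets has a deterministic protocol. -/
theorem DetProtocol.exists_run_eq {X Y Z : Type} [Finite X] [Finite Y] [Nonempty Z]
    (F : X → Y → Z) : ∃ P : DetProtocol X Y Z, ∀ x y, P.run x y = F x y := by
  classical
  obtain ⟨z₀⟩ := ‹Nonempty Z›
  have hbob : ∀ (G : Y → Z) (l : List Y),
      ∃ P : DetProtocol X Y Z, ∀ x, ∀ y ∈ l, P.run x y = G y := by
    intro G l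
    induction l with
    | nil => exact ⟨.leaf z₀, by simp⟩
    | cons y₀ l ih =>
      obtain ⟨P, hP⟩ := ih
      refine ⟨.bob (fun y => decide (y = y₀)) P (.leaf (G y₀)), fun x y hy => ?_⟩
      by_cases h : y = y₀
      · simp [DetProtocol.run, h]
      · have hy' : y ∈ l := by simpa [h] using hy
        simp [DetProtocol.run, h, hP x y hy']
  have halice : ∀ l : List X,
      ∃ P : DetProtocol X Y Z, ∀ x ∈ l, ∀ y, P.run x y = F x y := by
    intro l
    induction l with
    | nil => exact ⟨.leaf z₀, by simp⟩
    | cons x₀ l ih =>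
      obtain ⟨P, hP⟩ := ih
      have := Fintype.ofFinite Y
      obtain ⟨Q, hQ⟩ := hbob (F x₀) (Finset.univ : Finset Y).toList
      refine ⟨.alice (fun x => decide (x = x₀)) P Q, fun x hx y => ?_⟩
      by_cases h : x = x₀
      · simp [DetProtocol.run, h, hQ x₀ y (by simp)]
      · have hx' : x ∈ l := by simpa [h] using hx
        simp [DetProtocol.run, h, hP x hx' y]
  have := Fintype.ofFinite X
  obtain ⟨P, hP⟩ := halice (Finset.univ : Finset X).toList
  exact ⟨P, fun x y => hP x (by simp) y⟩

/-- The minimum in the definition of `randCC` is attained. -/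
theorem randCC_attained {X Y Z : Type} [Finite X] [Finite Y] [Nonempty Z]
    (f : X → Y → Option Z) :
    ∃ π : PublicCoinProtocol X Y Z, π.Computes f ∧ π.cost = (randCC f : ℕ∞) := by
  classical
  obtain ⟨z₀⟩ := ‹Nonempty Z›
  have : Nonempty Z := ⟨z₀⟩
  obtain ⟨P, hP⟩ := DetProtocol.exists_run_eq (fun x y => (f x y).getD z₀)
  have hne : {k : ℕ | ∃ π : PublicCoinProtocol X Y Z,
      π.Computes f ∧ π.cost ≤ (k : ℕ∞)}.Nonempty := by
    refine ⟨P.depth, PMF.pure P, ?_, ?_⟩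
    · intro x y z h
      have h1 : P.run x y = z := by rw [hP, h]; rfl
      have h2 : (2 / 3 : ℝ≥0∞) ≤ 1 :=
        ENNReal.div_le_of_le_mul (by norm_num)
      simpa [PublicCoinProtocol.output, PMF.pure_map, h1] using h2
    · simp [PublicCoinProtocol.cost]
  obtain ⟨π, hc, hk⟩ := Nat.sInf_mem hne
  refine ⟨π, hc, le_antisymm hk ?_⟩
  obtain ⟨m, hm⟩ := ENat.ne_top_iff_exists.mp (ne_top_of_le_ne_top (ENat.natCast_ne_top _) hk)
  rw [← hm]
  have hle : randCC f ≤ m := Nat.sInf_le ⟨π, hc, hm.symm.le⟩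
  exact_mod_cast hle

/-- The Hamming weight of a binary string. -/
def hammingWeight {n : ℕ} (x : Fin n → Bool) : ℕ :=
  (Finset.univ.filter fun i => x i = true).card

/-- The partial function Gap-Hamming-Distance: on strings of weights `a` and `b` it is `1` (`true`)
if the Hamming distance is at least `c + g`, and `0` (`false`) if it is at most `c - g`; it is
undefined (`none`) otherwise. -/
def GHD (n a b : ℕ) (c g : ℤ) (x y : Fin n → Bool) : Option Bool :=
  if hammingWeight x = a ∧ hammingWeight y = b then
    if c + g ≤ (hammingDist x y : ℤ) then some true
    else if (hammingDist x y : ℤ) ≤ c - g then some false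
    else none
  else none

/-! Each bound comes from a one-message round, run in independent copies, whose acceptance
probability depends on the Hamming distance. If the two cases lie on opposite sides of a threshold
`θ` with margin `δ`, Chebyshev shows that about `3 / δ ^ 2` copies, sent together, suffice
(`randCC_le_of_advantage`).

For the bound in `c / g`, a public random set contains each coordinate with probability `1 / (4c)`,
and Alice sends the parity of `x` on it. It differs from Bob's parity with probability `(1 - (1 -
1/(2c)) ^ Δ) / 2`, and passing from distance `c - g` to `c + g` moves this by order `g / c`. The
bound in `(n - c) / g` follows by complementing `y`, which replaces `Δ` by `n - Δ`.

For the bound in the weights, write `u = |x \ y|` and `w = |y \ x|`. Since `Δ = u + w` and `a - b =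
u - w`, it suffices to estimate `u = (Δ + a - b) / 2`. Hash coordinates into `2am` labels with `m =
⌈b/g⌉`. If exactly one element of `x` has a label below `m`, Alice sends that label, and Bob accepts
if no element of `y` has it. By independence the acceptance probability is `u` times a known
quantity of order `1 / a`, times `(1 - 1/(2am)) ^ w` (`card_labelMissed`). The last factor, the
chance of no false collision, is close enough to `1` to leave a margin of order `g / a`
(`hashing_gap`). A message costs about `log (b / g)` bits, and `(a / g) ^ 2` copies are needed up to
constants. -/

/-! ### One-way protocols and uniform public coins -/

/-- A one-way exchange: Alice sends `L` bits, Bob answers with the output. -/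
theorem DetProtocol.exists_oneWay {X Y : Type} (L : ℕ) (A : X → Fin L → Bool)
    (B : Y → (Fin L → Bool) → Bool) :
    ∃ P : DetProtocol X Y Bool, P.depth ≤ L + 1 ∧ ∀ x y, P.run x y = B y (A x) := by
  induction L with
  | zero =>
    refine ⟨.bob (fun y => B y Fin.elim0) (.leaf false) (.leaf true), by simp [depth], ?_⟩
    intro x y
    have : A x = Fin.elim0 := Subsingleton.elim _ _
    simp [run, this]
  | succ L ih =>
    obtain ⟨P₀, h₀, hr₀⟩ := ih (fun x => Fin.tail (A x)) (fun y v => B y (Fin.cons false v))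
    obtain ⟨P₁, h₁, hr₁⟩ := ih (fun x => Fin.tail (A x)) (fun y v => B y (Fin.cons true v))
    refine ⟨.alice (fun x => A x 0) P₀ P₁, by simp [depth, h₀, h₁], fun x y => ?_⟩
    have hc : Fin.cons (A x 0) (Fin.tail (A x)) = A x := Fin.cons_self_tail _
    cases h : A x 0 <;> rw [h] at hc <;> simp [run, h, hr₀, hr₁, hc]

/-- A one-way exchange with messages in an arbitrary finite type. -/
theorem DetProtocol.exists_oneWay_of_card_le {X Y M : Type} [Fintype M] (L : ℕ)
    (hM : Fintype.card M ≤ 2 ^ L) (A : X → M) (B : Y → M → Bool) :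
    ∃ P : DetProtocol X Y Bool, P.depth ≤ L + 1 ∧ ∀ x y, P.run x y = B y (A x) := by
  -- `Function.invFun` needs a nonempty `M`, which any input of Alice supplies.
  rcases isEmpty_or_nonempty X with hX | ⟨⟨x₀⟩⟩
  · exact ⟨.leaf true, by simp [depth], fun x => (hX.false x).elim⟩
  have : Nonempty M := ⟨A x₀⟩
  obtain ⟨e⟩ : Nonempty (M ↪ (Fin L → Bool)) :=
    Function.Embedding.nonempty_of_card_le (by simpa using hM)
  obtain ⟨P, hd, hr⟩ := exists_oneWay L (fun x => e (A x))
    (fun y v => B y (Function.invFun e v))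
  refine ⟨P, hd, fun x y => ?_⟩
  rw [hr, Function.leftInverse_invFun e.injective]

theorem randCC_le_of_computes {X Y Z : Type} {f : X → Y → Option Z} {k : ℕ}
    (π : PublicCoinProtocol X Y Z) (hπ : π.Computes f) (hk : π.cost ≤ (k : ℕ∞)) :
    randCC f ≤ k :=
  Nat.sInf_le ⟨π, hπ, hk⟩

/-- A partial function with at most one value needs no communication. -/
theorem randCC_eq_zero_of_const {X Y Z : Type} {f : X → Y → Option Z} (z₀ : Z)
    (h : ∀ x y z, f x y = some z → z = z₀) : randCC f = 0 := by
  refine Nat.le_zero.mp (randCC_le_of_computes (PMF.pure (.leaf z₀)) ?_ ?_)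
  · intro x y z hz
    have h2 : (2 / 3 : ℝ≥0∞) ≤ 1 := ENNReal.div_le_of_le_mul (by norm_num)
    simpa [PublicCoinProtocol.output, PMF.pure_map, DetProtocol.run, h x y z hz] using h2
  · simp [PublicCoinProtocol.cost, DetProtocol.depth]

/-- A protocol whose public coins are uniform on a finite set. -/
theorem randCC_le_of_uniform {X Y Z Ω : Type} [Fintype Ω] [Nonempty Ω] [DecidableEq Z]
    {f : X → Y → Option Z} {k : ℕ} (P : Ω → DetProtocol X Y Z) (hk : ∀ ω, (P ω).depth ≤ k)
    (h : ∀ x y z, f x y = some z →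
      3 * (Finset.univ.filter fun ω => (P ω).run x y ≠ z).card ≤ Fintype.card Ω) :
    randCC f ≤ k := by
  classical
  refine randCC_le_of_computes ((PMF.uniformOfFintype Ω).map P) ?_ ?_
  · intro x y z hz
    have h1 := h x y z hz
    have hsum := Finset.card_filter_add_card_filter_not (s := (Finset.univ : Finset Ω))
      (fun ω => (P ω).run x y = z)
    rw [Finset.card_univ] at hsum
    have hval : PublicCoinProtocol.output ((PMF.uniformOfFintype Ω).map P) x y z =
        ((Finset.univ.filter fun ω => (P ω).run x y = z).card : ℝ≥0∞) / Fintype.card Ω := by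
      rw [PublicCoinProtocol.output, PMF.map_comp, PMF.map_apply, tsum_fintype]
      simp only [Function.comp, PMF.uniformOfFintype_apply, eq_comm (a := z)]
      rw [← Finset.sum_filter, Finset.sum_const, nsmul_eq_mul, div_eq_mul_inv]
    have hc : (Fintype.card Ω : ℝ≥0∞) ≠ 0 := by simp
    rw [hval, ENNReal.le_div_iff_mul_le (Or.inl hc) (Or.inl (by simp)), mul_comm,
      ← mul_div_assoc]
    refine ENNReal.div_le_of_le_mul ?_
    have : Fintype.card Ω * 2 ≤ (Finset.univ.filter fun ω => (P ω).run x y = z).card * 3 := by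
      simp only [ne_eq] at h1
      omega
    exact_mod_cast this
  · refine iSup₂_le fun Q hQ => ?_
    rw [PMF.support_map] at hQ
    obtain ⟨ω, -, rfl⟩ := hQ
    exact_mod_cast hk ω

/-! ### Chebyshev's inequality and amplification -/

/-- The second moment of a sum of independent centred variables bounded by `1`. -/
theorem sum_sq_sum_le {Ω : Type} [Fintype Ω] (W : Ω → ℝ) (h0 : ∑ ω, W ω = 0)
    (h1 : ∀ ω, W ω ^ 2 ≤ 1) (k : ℕ) :
    ∑ v : Fin k → Ω, (∑ j, W (v j)) ^ 2 ≤ k * (Fintype.card Ω : ℝ) ^ k := by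
  induction k with
  | zero => simp
  | succ k ih =>
    have hcross : ∑ ω, ∑ v : Fin k → Ω, 2 * W ω * ∑ j, W (v j) = 0 := by
      simp_rw [mul_assoc, ← Finset.mul_sum, ← Finset.sum_mul, h0]
      simp
    have hW : ∑ ω, W ω ^ 2 ≤ Fintype.card Ω := by
      calc ∑ ω, W ω ^ 2 ≤ ∑ _ω : Ω, (1 : ℝ) := Finset.sum_le_sum fun ω _ => h1 ω
        _ = _ := by simp
    have hfirst : ∑ ω, ∑ _v : Fin k → Ω, W ω ^ 2 ≤ (Fintype.card Ω : ℝ) ^ (k + 1) := by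
      simp only [Finset.sum_const, Finset.card_univ, Fintype.card_fun, Fintype.card_fin,
        nsmul_eq_mul, ← Finset.mul_sum, Nat.cast_pow]
      rw [pow_succ (Fintype.card Ω : ℝ)]
      gcongr
    rw [← (Fin.consEquiv fun _ : Fin (k + 1) => Ω).sum_comp, Fintype.sum_prod_type]
    simp only [Fin.consEquiv_apply, Fin.sum_univ_succ, Fin.cons_zero, Fin.cons_succ, add_sq,
      Finset.sum_add_distrib, hcross]
    have hlast : ∑ _ω : Ω, ∑ v : Fin k → Ω, (∑ j, W (v j)) ^ 2
        ≤ k * (Fintype.card Ω : ℝ) ^ (k + 1) := by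
      rw [Finset.sum_const, Finset.card_univ, nsmul_eq_mul, pow_succ]
      nlinarith [mul_le_mul_of_nonneg_left ih (Nat.cast_nonneg (α := ℝ) (Fintype.card Ω))]
    push_cast
    linarith

/-- Chebyshev's inequality for `k` independent samples of an event. -/
theorem three_mul_card_deviation_le {Ω : Type} [Fintype Ω] [Nonempty Ω] (Z : Ω → Bool)
    (p δ : ℝ) (k : ℕ) (hp : ((Finset.univ.filter fun ω => Z ω = true).card : ℝ) =
      p * Fintype.card Ω) (hδ : 0 < δ) (hk : 3 ≤ k * δ ^ 2)
    (S : Finset (Fin k → Ω))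
    (hS : ∀ v ∈ S, k * δ ≤ |((Finset.univ.filter fun j => Z (v j) = true).card : ℝ) - k * p|) :
    3 * S.card ≤ Fintype.card (Fin k → Ω) := by
  have hcard : (0 : ℝ) < Fintype.card Ω := by exact_mod_cast Fintype.card_pos
  have hp1 : p ≤ 1 := by
    have : ((Finset.univ.filter fun ω => Z ω = true).card : ℝ) ≤ Fintype.card Ω := by
      exact_mod_cast Finset.card_le_univ _
    nlinarith
  have hp0 : 0 ≤ p := by
    have : (0 : ℝ) ≤ p * Fintype.card Ω := hp ▸ Nat.cast_nonneg _
    exact nonneg_of_mul_nonneg_left this hcard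
  set W : Ω → ℝ := fun ω => (if Z ω = true then 1 else 0) - p with hW
  have h0 : ∑ ω, W ω = 0 := by
    simp only [hW, Finset.sum_sub_distrib, Finset.sum_boole, hp]
    simp [mul_comm]
  have h1 : ∀ ω, W ω ^ 2 ≤ 1 := by
    intro ω
    simp only [hW]
    split_ifs <;> nlinarith
  have hm := sum_sq_sum_le W h0 h1 k
  have hlow : S.card * (k * δ) ^ 2 ≤ ∑ v : Fin k → Ω, (∑ j, W (v j)) ^ 2 := by
    calc S.card * (k * δ) ^ 2 = ∑ _v ∈ S, (k * δ) ^ 2 := by simp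
      _ ≤ ∑ v ∈ S, (∑ j, W (v j)) ^ 2 := by
        refine Finset.sum_le_sum fun v hv => ?_
        have h := hS v hv
        have he : ∑ j, W (v j) =
            ((Finset.univ.filter fun j => Z (v j) = true).card : ℝ) - k * p := by
          simp [hW, Finset.sum_sub_distrib, Finset.sum_boole]
        rw [he, ← sq_abs (_ - _ : ℝ)]
        gcongr
      _ ≤ _ := Finset.sum_le_sum_of_subset_of_nonneg (Finset.subset_univ _)
        fun _ _ _ => sq_nonneg _
  have hk0 : (0 : ℝ) < k := by
    by_contra h
    have : (k : ℝ) = 0 := le_antisymm (not_lt.mp h) (Nat.cast_nonneg k)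
    rw [this] at hk
    norm_num at hk
  have hfin : (S.card : ℝ) * (k * δ ^ 2) ≤ (Fintype.card Ω : ℝ) ^ k := by
    have : (k : ℝ) * (S.card * (k * δ ^ 2)) ≤ k * (Fintype.card Ω : ℝ) ^ k := by
      calc (k : ℝ) * (S.card * (k * δ ^ 2)) = S.card * (k * δ) ^ 2 := by ring
        _ ≤ _ := hlow.trans hm
    exact le_of_mul_le_mul_left this hk0
  have : (3 : ℝ) * S.card ≤ (Fintype.card Ω : ℝ) ^ k := by
    nlinarith [mul_le_mul_of_nonneg_left hk (Nat.cast_nonneg (α := ℝ) S.card)]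
  rw [Fintype.card_fun, Fintype.card_fin]
  exact_mod_cast this

/-- Amplification: `k` independent copies of a one-way round whose acceptance probability is at
least `θ + δ` on inputs of value `σ` and at most `θ - δ` on inputs of value `!σ`. -/
theorem randCC_le_of_advantage {X Y M Ω : Type} [Fintype Ω] [Nonempty Ω] [Fintype M]
    {f : X → Y → Option Bool} (σ : Bool) (s k : ℕ) (hM : Fintype.card M ≤ 2 ^ s)
    (A : Ω → X → M) (B : Ω → Y → M → Bool) (θ δ : ℝ) (hδ : 0 < δ) (hk : 3 ≤ k * δ ^ 2)
    (hhi : ∀ x y, f x y = some σ → (θ + δ) * Fintype.card Ω ≤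
      ((Finset.univ.filter fun ω => B ω y (A ω x) = true).card : ℝ))
    (hlo : ∀ x y, f x y = some (!σ) →
      ((Finset.univ.filter fun ω => B ω y (A ω x) = true).card : ℝ) ≤
        (θ - δ) * Fintype.card Ω) :
    randCC f ≤ s * k + 1 := by
  classical
  have hcard : (0 : ℝ) < Fintype.card Ω := by exact_mod_cast Fintype.card_pos
  -- Bob compares the number of accepting copies with its threshold `k * θ`; the test `== σ` turns
  -- "many" into `σ` and "few" into `!σ`.
  let D (v : Fin k → Ω) (y : Y) (μ : Fin k → M) : Bool :=
    decide ((k : ℝ) * θ ≤ ((Finset.univ.filter fun j => B (v j) y (μ j) = true).card : ℝ)) == σ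
  have hex : ∀ v : Fin k → Ω, ∃ P : DetProtocol X Y Bool, P.depth ≤ s * k + 1 ∧
      ∀ x y, P.run x y = D v y (fun j => A (v j) x) := fun v =>
    DetProtocol.exists_oneWay_of_card_le (M := Fin k → M) (s * k)
      (by rw [Fintype.card_fun, Fintype.card_fin, pow_mul]; exact Nat.pow_le_pow_left hM k)
      (fun x j => A (v j) x) (D v)
  choose P hd hr using hex
  refine randCC_le_of_uniform P hd fun x y z hz => ?_
  set N : ℝ := ((Finset.univ.filter fun ω => B ω y (A ω x) = true).card : ℝ) with hN
  refine three_mul_card_deviation_le (fun ω => B ω y (A ω x)) (N / Fintype.card Ω) δ k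
    (by rw [div_mul_cancel₀ _ hcard.ne']) hδ hk _ fun v hv => ?_
  have hv' : D v y (fun j => A (v j) x) ≠ z := by
    rw [← hr]
    exact (Finset.mem_filter.mp hv).2
  by_cases hσ : z = σ
  · have h1 : θ + δ ≤ N / Fintype.card Ω := by
      rw [le_div_iff₀ hcard]
      exact hhi x y (hσ ▸ hz)
    have h2 : ¬ ((k : ℝ) * θ ≤
        ((Finset.univ.filter fun j => B (v j) y (A (v j) x) = true).card : ℝ)) := by
      intro hle
      apply hv'
      simp only [D, hle, hσ]
      cases σ <;> simp
    have := mul_le_mul_of_nonneg_left h1 (Nat.cast_nonneg (α := ℝ) k)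
    rw [abs_sub_comm]
    refine le_trans ?_ (le_abs_self _)
    linarith
  · have hz' : z = !σ := by cases z <;> cases σ <;> simp_all
    have h1 : N / Fintype.card Ω ≤ θ - δ := by
      rw [div_le_iff₀ hcard]
      exact hlo x y (hz' ▸ hz)
    have h2 : (k : ℝ) * θ ≤
        ((Finset.univ.filter fun j => B (v j) y (A (v j) x) = true).card : ℝ) := by
      by_contra hle
      apply hv'
      simp only [D, hle, hz']
      cases σ <;> simp
    have := mul_le_mul_of_nonneg_left h1 (Nat.cast_nonneg (α := ℝ) k)
    refine le_trans ?_ (le_abs_self _)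
    linarith

/-! ### The parity sketch -/

/-- The sign of the parity of `x` on the random subset `{i | h i = 0}`. -/
def paritySketch {n N : ℕ} [NeZero N] (h : Fin n → Fin N) (x : Fin n → Bool) : ℤˣ :=
  ∏ i, if x i = true ∧ h i = 0 then -1 else 1

theorem paritySketch_mul {n N : ℕ} [NeZero N] (h : Fin n → Fin N) (x y : Fin n → Bool) :
    paritySketch h x * paritySketch h y = ∏ i, if x i ≠ y i ∧ h i = 0 then -1 else 1 := by
  rw [paritySketch, paritySketch, ← Finset.prod_mul_distrib]
  refine Finset.prod_congr rfl fun i _ => ?_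
  cases x i <;> cases y i <;> by_cases h0 : h i = 0 <;> simp [h0]

/-- Coordinates are hashed independently, so the sum factors. A coordinate where `x` and `y` agree
contributes `N`; one where they differ contributes `N - 2`, since exactly one hash value flips the
sign. -/
theorem sum_paritySketch_mul {n N : ℕ} [NeZero N] (x y : Fin n → Bool) :
    ∑ h : Fin n → Fin N, (((paritySketch h x * paritySketch h y : ℤˣ) : ℤ) : ℝ) =
      (1 - 2 / N) ^ hammingDist x y * (N : ℝ) ^ n := by
  have hN : (N : ℝ) ≠ 0 := by exact_mod_cast NeZero.ne N
  have hcoord : ∀ i : Fin n, ∑ j : Fin N, (if x i ≠ y i ∧ j = 0 then (-1 : ℝ) else 1) =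
      (if x i ≠ y i then (1 - 2 / N : ℝ) else 1) * N := by
    intro i
    by_cases hxy : x i ≠ y i
    · have : ∀ j : Fin N, (if x i ≠ y i ∧ j = 0 then (-1 : ℝ) else 1) =
          1 - (if j = 0 then 2 else 0) := by
        intro j
        by_cases hj : j = 0 <;> simp [hxy, hj]; norm_num
      simp only [this, Finset.sum_sub_distrib, Finset.sum_ite_eq', if_pos hxy]
      simp
      field_simp
    · simp [hxy]
  calc ∑ h : Fin n → Fin N, (((paritySketch h x * paritySketch h y : ℤˣ) : ℤ) : ℝ)
      = ∑ h : Fin n → Fin N, ∏ i, (if x i ≠ y i ∧ h i = 0 then (-1 : ℝ) else 1) := by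
        refine Finset.sum_congr rfl fun h _ => ?_
        rw [paritySketch_mul]
        push_cast
        refine Finset.prod_congr rfl fun i _ => ?_
        split_ifs <;> simp
    _ = ∏ i : Fin n, ∑ j : Fin N, (if x i ≠ y i ∧ j = 0 then (-1 : ℝ) else 1) := by
        rw [Finset.prod_univ_sum, Fintype.piFinset_univ]
    _ = _ := by
        simp_rw [hcoord, Finset.prod_mul_distrib]
        rw [Finset.prod_ite]
        simp [hammingDist]

/-- The number of hash functions for which the parity sketches of `x` and `y` differ. -/
theorem card_paritySketch_ne {n N : ℕ} [NeZero N] (x y : Fin n → Bool) :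
    ((Finset.univ.filter fun h : Fin n → Fin N =>
      decide (paritySketch h x ≠ paritySketch h y) = true).card : ℝ) =
      (1 - (1 - 2 / N) ^ hammingDist x y) / 2 * Fintype.card (Fin n → Fin N) := by
  have hind : ∀ h : Fin n → Fin N,
      (if decide (paritySketch h x ≠ paritySketch h y) = true then (1 : ℝ) else 0) =
        1 / 2 - (((paritySketch h x * paritySketch h y : ℤˣ) : ℤ) : ℝ) / 2 := by
    intro h
    rcases Int.units_eq_one_or (paritySketch h x) with h1 | h1 <;>
    rcases Int.units_eq_one_or (paritySketch h y) with h2 | h2 <;>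
    rw [h1, h2] <;> norm_num
  rw [← Finset.sum_boole]
  simp_rw [hind, Finset.sum_sub_distrib, ← Finset.sum_div, sum_paritySketch_mul]
  simp
  ring

/-- With `u = 1/(2c)` the difference is `(1 - u) ^ (c - g) * (1 - (1 - u) ^ (2g))`. Bernoulli bounds
the first factor below by `1/2`; since `(1 - u)(1 + u) ≤ 1`, Bernoulli for `1 + u` bounds the second
below by `u * g`. -/
theorem parity_gap {c g : ℕ} (hg : 0 < g) (hgc : g ≤ c) :
    (g : ℝ) / (4 * c) ≤ (1 - 2 / ((4 * c : ℕ) : ℝ)) ^ (c - g) -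
      (1 - 2 / ((4 * c : ℕ) : ℝ)) ^ (c + g) := by
  have hc1 : (1 : ℝ) ≤ c := by exact_mod_cast hg.trans_le hgc
  have hg0 : (0 : ℝ) < g := by exact_mod_cast hg
  have hgc' : (g : ℝ) ≤ c := by exact_mod_cast hgc
  set u : ℝ := 1 / (2 * c) with hu
  have hu0 : 0 < u := by positivity
  have hu1 : u ≤ 1 / 2 := by
    rw [hu, div_le_div_iff₀ (by positivity) (by norm_num)]
    linarith
  have hβ : (1 - 2 / ((4 * c : ℕ) : ℝ)) = 1 - u := by
    rw [hu]
    push_cast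
    field_simp
    ring
  have huc : u * c = 1 / 2 := by rw [hu]; field_simp
  have hfst : (1 / 2 : ℝ) ≤ (1 - u) ^ (c - g) := by
    have h1 := one_add_mul_le_pow (a := -u) (by linarith) (c - g)
    have h2 : ((c - g : ℕ) : ℝ) ≤ c := by exact_mod_cast Nat.sub_le c g
    have h3 : ((c - g : ℕ) : ℝ) * u ≤ 1 / 2 := by nlinarith
    rw [← sub_eq_add_neg] at h1
    linarith
  have hug : u * g ≤ 1 / 2 := by nlinarith
  have hugeq : u * g = g / (2 * c) := by rw [hu]; ring
  have hsnd : g / (2 * c) ≤ 1 - (1 - u) ^ (2 * g) := by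
    have h1 := one_add_mul_le_pow (a := u) (by linarith) (2 * g)
    have h2 : (1 - u) ^ (2 * g) * (1 + u) ^ (2 * g) ≤ 1 := by
      rw [← mul_pow]
      exact pow_le_one₀ (by nlinarith) (by nlinarith)
    have h3 : 0 ≤ (1 - u) ^ (2 * g) := pow_nonneg (by linarith) _
    have h4 : (1 - u) ^ (2 * g) * (1 + 2 * (u * g)) ≤ 1 := by
      refine le_trans (mul_le_mul_of_nonneg_left ?_ h3) h2
      push_cast at h1
      linarith
    rw [← hugeq]
    have h5 : 0 < u * g := by positivity
    nlinarith
  rw [hβ]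
  have hsplit : (1 - u) ^ (c + g) = (1 - u) ^ (c - g) * (1 - u) ^ (2 * g) := by
    rw [← pow_add]
    congr 1
    omega
  rw [hsplit]
  have h6 : (g : ℝ) / (4 * c) = 1 / 2 * (g / (2 * c)) := by field_simp; norm_num
  have h7 : (0 : ℝ) ≤ g / (2 * c) := by positivity
  have := mul_le_mul hfst hsnd h7 (by linarith)
  rw [h6]
  linarith

/-- Deciding whether the Hamming distance of `x` and `ψ y` is at least `c + g` or at most
`c - g` costs `O((c / g)²)` bits. -/
theorem randCC_le_of_hammingDist_gap {n : ℕ} {Y : Type} {f : (Fin n → Bool) → Y → Option Bool}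
    (σ : Bool) (ψ : Y → Fin n → Bool) {c g : ℕ} (hg : 0 < g) (hgc : g ≤ c)
    (hhi : ∀ x y, f x y = some σ → c + g ≤ hammingDist x (ψ y))
    (hlo : ∀ x y, f x y = some (!σ) → hammingDist x (ψ y) ≤ c - g) :
    (randCC f : ℝ) ≤ 800 * ((c : ℝ) / g) ^ 2 := by
  have : NeZero (4 * c) := ⟨by omega⟩
  have hc1 : (1 : ℝ) ≤ c := by exact_mod_cast hg.trans_le hgc
  have hg0 : (0 : ℝ) < g := by exact_mod_cast hg
  have hgc' : (g : ℝ) ≤ c := by exact_mod_cast hgc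
  set β : ℝ := 1 - 2 / ((4 * c : ℕ) : ℝ) with hβ
  have hβ0 : 0 ≤ β := by
    have hN : (2 : ℝ) ≤ ((4 * c : ℕ) : ℝ) := by push_cast; linarith
    rw [hβ, sub_nonneg, div_le_one (by linarith)]
    exact hN
  have hβ1 : β ≤ 1 := by
    rw [hβ, sub_le_self_iff]
    positivity
  have hgap : (g : ℝ) / (4 * c) ≤ β ^ (c - g) - β ^ (c + g) := parity_gap hg hgc
  set r : ℝ := (c : ℝ) / g with hr
  have hr1 : 1 ≤ r := by rw [hr, le_div_iff₀ hg0]; linarith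
  have hδr : (g : ℝ) / (16 * c) = 1 / (16 * r) := by rw [hr]; field_simp
  -- The constant is `768 = 3 * 16 ^ 2`.
  have hk : 3 ≤ (⌈768 * r ^ 2⌉₊ : ℝ) * ((g : ℝ) / (16 * c)) ^ 2 := by
    have := Nat.le_ceil (768 * r ^ 2)
    calc (3 : ℝ) = 768 * r ^ 2 * ((g : ℝ) / (16 * c)) ^ 2 := by
          rw [hδr]; field_simp; norm_num
      _ ≤ _ := by gcongr
  -- The threshold is the midpoint of the acceptance probabilities at distances `c - g` and `c + g`.
  -- These differ by at least `g / (8c)`, half the gap in `parity_gap`, so the margin is `g /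
  -- (16c)`.
  have hmain := randCC_le_of_advantage (f := f) (Ω := Fin n → Fin (4 * c)) (M := ℤˣ) σ 1
    ⌈768 * r ^ 2⌉₊ (by simp) paritySketch
    (fun h y m => decide (m ≠ paritySketch h (ψ y)))
    ((1 - (β ^ (c - g) + β ^ (c + g)) / 2) / 2) ((g : ℝ) / (16 * c)) (by positivity) hk ?_ ?_
  · have h1 := Nat.ceil_lt_add_one (show 0 ≤ 768 * r ^ 2 by positivity)
    have h2 : (randCC f : ℝ) ≤ ⌈768 * r ^ 2⌉₊ + 1 := by
      rw [one_mul] at hmain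
      exact_mod_cast hmain
    nlinarith
  · intro x y hxy
    rw [card_paritySketch_ne, ← hβ]
    refine mul_le_mul_of_nonneg_right ?_ (Nat.cast_nonneg _)
    have h1 := pow_le_pow_of_le_one hβ0 hβ1 (hhi x y hxy)
    have h2 : (g : ℝ) / (16 * c) = g / (4 * c) / 4 := by field_simp; norm_num
    linarith
  · intro x y hxy
    rw [card_paritySketch_ne, ← hβ]
    refine mul_le_mul_of_nonneg_right ?_ (Nat.cast_nonneg _)
    have h1 := pow_le_pow_of_le_one hβ0 hβ1 (hlo x y hxy)
    have h2 : (g : ℝ) / (16 * c) = g / (4 * c) / 4 := by field_simp; norm_num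
    linarith

/-! ### The hashing round and its exact acceptance probability -/

/-- The label below `m` of the unique element of `x` that has one, if there is such an element. -/
noncomputable def uniqueLabel {n N : ℕ} (m : ℕ) (h : Fin n → Fin N) (x : Fin n → Bool) :
    Option (Fin m) :=
  open Classical in
  if H : ∃ l : Fin m, ∃ i, x i = true ∧ (h i : ℕ) = l ∧
    ∀ j, x j = true → j ≠ i → m ≤ (h j : ℕ) then some H.choose else none

theorem uniqueLabel_eq_some_iff {n N m : ℕ} (h : Fin n → Fin N) (x : Fin n → Bool) (l : Fin m) :
    uniqueLabel m h x = some l ↔ ∃ i, x i = true ∧ (h i : ℕ) = l ∧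
      ∀ j, x j = true → j ≠ i → m ≤ (h j : ℕ) := by
  unfold uniqueLabel
  split_ifs with H
  · obtain ⟨i, hi, hil, hij⟩ := H.choose_spec
    constructor
    · intro he
      rw [Option.some_inj] at he
      exact ⟨i, hi, by rw [hil, he], hij⟩
    · rintro ⟨i', hi', hil', hij'⟩
      have hii : i = i' := by
        by_contra hne
        have := hij' i hi hne
        have := H.choose.2
        omega
      subst hii
      rw [Option.some_inj]
      exact Fin.ext (hil.symm.trans hil')
  · simp only [false_iff]
    exact fun hl => H ⟨l, hl⟩

/-- Bob's test: a label was sent, and no element of `y` has it. -/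
def labelMissed {n N m : ℕ} (h : Fin n → Fin N) (y : Fin n → Bool) : Option (Fin m) → Bool
  | none => false
  | some l => decide (∀ j, y j = true → (h j : ℕ) ≠ l)

theorem labelMissed_uniqueLabel_iff {n N m : ℕ} (h : Fin n → Fin N) (x y : Fin n → Bool) :
    labelMissed h y (uniqueLabel m h x) = true ↔
      ∃ i, ∃ l : Fin m, x i = true ∧ y i = false ∧ (h i : ℕ) = l ∧
        (∀ j, x j = true → j ≠ i → m ≤ (h j : ℕ)) ∧ ∀ j, y j = true → (h j : ℕ) ≠ l := by
  constructor
  · intro H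
    rcases hu : uniqueLabel m h x with _ | l
    · simp [hu, labelMissed] at H
    · rw [hu] at H
      obtain ⟨i, hi, hil, hij⟩ := (uniqueLabel_eq_some_iff h x l).mp hu
      have H' : ∀ j, y j = true → (h j : ℕ) ≠ l := by simpa [labelMissed] using H
      refine ⟨i, l, hi, ?_, hil, hij, H'⟩
      by_contra hy
      exact H' i (by simpa using hy) hil
  · rintro ⟨i, l, hi, -, hil, hij, hyl⟩
    rw [(uniqueLabel_eq_some_iff h x l).mpr ⟨i, hi, hil, hij⟩]
    simpa [labelMissed] using hyl

/-- The values allowed at `j` if the element `i` is to carry the missed label `l`. -/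
def missSet {n N m : ℕ} (hmN : m ≤ N) (x y : Fin n → Bool) (i : Fin n) (l : Fin m) (j : Fin n) :
    Finset (Fin N) :=
  if j = i then {Fin.castLE hmN l}
  else if x j = true then Finset.univ.filter fun v => m ≤ (v : ℕ)
  else if y j = true then Finset.univ.erase (Fin.castLE hmN l)
  else Finset.univ

/-- The event is a product of conditions on single coordinates. An element of `x` and `y` needs no
separate condition to avoid `l`, because its label is already at least `m`. -/
theorem mem_piFinset_missSet {n N m : ℕ} (hmN : m ≤ N) (x y : Fin n → Bool) (i : Fin n)
    (l : Fin m) (hi : x i = true) (hy : y i = false) (h : Fin n → Fin N) :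
    h ∈ Fintype.piFinset (missSet hmN x y i l) ↔ (h i : ℕ) = l ∧
      (∀ j, x j = true → j ≠ i → m ≤ (h j : ℕ)) ∧ ∀ j, y j = true → (h j : ℕ) ≠ l := by
  rw [Fintype.mem_piFinset]
  constructor
  · intro H
    refine ⟨?_, fun j hj hji => ?_, fun j hj => ?_⟩
    · simpa [missSet, Fin.ext_iff] using H i
    · simpa [missSet, hji, hj] using H j
    · have hji : j ≠ i := by rintro rfl; simp [hj] at hy
      have := H j
      by_cases hx : x j = true
      · have h2 : m ≤ (h j : ℕ) := by simpa [missSet, hji, hx] using this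
        have := l.2
        omega
      · simpa [missSet, hji, hx, hj, Fin.ext_iff] using this
  · rintro ⟨h1, h2, h3⟩ j
    unfold missSet
    split_ifs with c1 c2 c3
    · subst c1
      simpa [Fin.ext_iff] using h1
    · simpa using h2 j c2 c1
    · simpa [Fin.ext_iff] using h3 j c3
    · simp

theorem card_piFinset_missSet {n N m : ℕ} (hN : 0 < N) (hmN : m ≤ N) (x y : Fin n → Bool)
    (i : Fin n) (l : Fin m) (hi : x i = true) (hy : y i = false) :
    ((Fintype.piFinset (missSet hmN x y i l)).card : ℝ) =
      1 / N * (1 - m / N) ^ (hammingWeight x - 1) *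
        (1 - 1 / N) ^ (Finset.univ.filter fun j => x j = false ∧ y j = true).card *
          (N : ℝ) ^ n := by
  have hN' : (N : ℝ) ≠ 0 := by exact_mod_cast hN.ne'
  have hcard : ∀ j, ((missSet hmN x y i l j).card : ℝ) =
      (if j = i then (1 / N : ℝ) else 1) * (if j ≠ i ∧ x j = true then (1 - m / N : ℝ) else 1) *
        (if x j = false ∧ y j = true then (1 - 1 / N : ℝ) else 1) * N := by
    intro j
    unfold missSet
    by_cases hji : j = i
    · subst hji
      simp [hi, hN']
    by_cases hx : x j = true
    · have hc : (Finset.univ.filter fun v : Fin N => m ≤ (v : ℕ)).card = N - m := by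
        have h1 := Finset.card_filter_add_card_filter_not (s := (Finset.univ : Finset (Fin N)))
          (fun v : Fin N => (v : ℕ) < m)
        have h2 : (Finset.univ.filter fun v : Fin N => (v : ℕ) < m).card = m := by
          rw [Fin.card_filter_val_lt]
          exact min_eq_right hmN
        simp only [not_lt, Finset.card_univ, Fintype.card_fin] at h1
        omega
      simp only [hji, hx, if_true, if_false, hc, Nat.cast_sub hmN]
      simp [hji]
      field_simp
    · by_cases hyj : y j = true
      · simp [hji, hx, hyj, Nat.cast_sub (Nat.one_le_iff_ne_zero.mpr hN.ne')]
        field_simp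
      · simp [hji, hx, hyj]
  have hw : (Finset.univ.filter fun j => j ≠ i ∧ x j = true).card = hammingWeight x - 1 := by
    have : (Finset.univ.filter fun j => j ≠ i ∧ x j = true) =
        (Finset.univ.filter fun j => x j = true).erase i := by
      ext j
      simp
    rw [this, Finset.card_erase_of_mem (by simp [hi]), hammingWeight]
  rw [Fintype.card_piFinset, Nat.cast_prod]
  simp_rw [hcard, Finset.prod_mul_distrib]
  simp only [Finset.prod_ite, Finset.prod_const, hw]
  simp [Finset.filter_eq']

/-- The exact number of hash functions for which Bob's test succeeds. -/
theorem card_labelMissed {n N m : ℕ} (hN : 0 < N) (hmN : m ≤ N) (x y : Fin n → Bool) :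
    ((Finset.univ.filter fun h : Fin n → Fin N =>
      labelMissed h y (uniqueLabel m h x) = true).card : ℝ) =
      (Finset.univ.filter fun j => x j = true ∧ y j = false).card *
        (m / N * (1 - m / N) ^ (hammingWeight x - 1)) *
        (1 - 1 / N) ^ (Finset.univ.filter fun j => x j = false ∧ y j = true).card *
          Fintype.card (Fin n → Fin N) := by
  classical
  set U := Finset.univ.filter fun j => x j = true ∧ y j = false with hU
  have hset : (Finset.univ.filter fun h : Fin n → Fin N =>
      labelMissed h y (uniqueLabel m h x) = true) =
      (U ×ˢ (Finset.univ : Finset (Fin m))).biUnion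
        fun q => Fintype.piFinset (missSet hmN x y q.1 q.2) := by
    ext h
    simp only [Finset.mem_filter, Finset.mem_univ, true_and, labelMissed_uniqueLabel_iff,
      Finset.mem_biUnion, Finset.mem_product, and_true, Prod.exists, hU]
    refine exists_congr fun i => exists_congr fun l => ?_
    constructor
    · rintro ⟨hi, hy, H⟩
      exact ⟨⟨hi, hy⟩, (mem_piFinset_missSet hmN x y i l hi hy h).mpr H⟩
    · rintro ⟨⟨hi, hy⟩, H⟩
      exact ⟨hi, hy, (mem_piFinset_missSet hmN x y i l hi hy h).mp H⟩
  rw [hset, Finset.card_biUnion]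
  · rw [Nat.cast_sum, Finset.sum_congr rfl (g := fun _ =>
      1 / N * (1 - m / N) ^ (hammingWeight x - 1) *
        (1 - 1 / N) ^ (Finset.univ.filter fun j => x j = false ∧ y j = true).card *
          (N : ℝ) ^ n)]
    · simp
      ring
    · rintro ⟨i, l⟩ hq
      simp only [hU, Finset.mem_product, Finset.mem_filter, Finset.mem_univ, true_and,
        and_true] at hq
      exact card_piFinset_missSet hN hmN x y i l hq.1 hq.2
  -- The events are disjoint: `h` determines `i` as the only element of `x` labelled below `m`, and
  -- `l` as its label.
  · rintro ⟨i, l⟩ hq ⟨i', l'⟩ hq' hne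
    simp only [hU, Finset.mem_coe, Finset.mem_product, Finset.mem_filter, Finset.mem_univ,
      true_and, and_true] at hq hq'
    rw [Function.onFun, Finset.disjoint_left]
    intro h hh hh'
    obtain ⟨h1, h2, -⟩ := (mem_piFinset_missSet hmN x y i l hq.1 hq.2 h).mp hh
    obtain ⟨h1', -, -⟩ := (mem_piFinset_missSet hmN x y i' l' hq'.1 hq'.2 h).mp hh'
    by_cases hii : i' = i
    · subst hii
      exact hne (Prod.ext rfl (Fin.ext (h1.symm.trans h1')))
    · have := h2 i' hq'.1 hii
      have := l'.2
      omega

/-! ### Parameters and cost of the hashing protocol -/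

theorem hammingDist_eq_add {n : ℕ} (x y : Fin n → Bool) :
    hammingDist x y = (Finset.univ.filter fun j => x j = true ∧ y j = false).card +
      (Finset.univ.filter fun j => x j = false ∧ y j = true).card := by
  rw [hammingDist, ← Finset.card_union_of_disjoint]
  · congr 1
    ext j
    cases h1 : x j <;> cases h2 : y j <;> simp [h1, h2]
  · rw [Finset.disjoint_left]
    intro j h1 h2
    simp_all

theorem hammingWeight_eq_add_left {n : ℕ} (x y : Fin n → Bool) :
    hammingWeight x = (Finset.univ.filter fun j => x j = true ∧ y j = false).card +
      (Finset.univ.filter fun j => x j = true ∧ y j = true).card := by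
  rw [hammingWeight, ← Finset.card_union_of_disjoint]
  · congr 1
    ext j
    cases h1 : x j <;> cases h2 : y j <;> simp [h1, h2]
  · rw [Finset.disjoint_left]
    intro j h1 h2
    simp_all

theorem hammingWeight_eq_add_right {n : ℕ} (x y : Fin n → Bool) :
    hammingWeight y = (Finset.univ.filter fun j => x j = false ∧ y j = true).card +
      (Finset.univ.filter fun j => x j = true ∧ y j = true).card := by
  simpa only [and_comm] using hammingWeight_eq_add_left y x

theorem GHD_eq_some_iff {n a b : ℕ} {c g : ℤ} (hg : 0 < g) (x y : Fin n → Bool) (z : Bool) :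
    GHD n a b c g x y = some z ↔ hammingWeight x = a ∧ hammingWeight y = b ∧
      if z then c + g ≤ (hammingDist x y : ℤ) else (hammingDist x y : ℤ) ≤ c - g := by
  unfold GHD
  split_ifs with h1 h2 h3 h4 h5 <;> simp_all; omega

/-- Here `υ` is the value of `u` at distance `c`, so the two cases are `g / 2` above and below it.
Collisions lower `u` by at most `u * b / (2am) ≤ g / 2`, so the effective values are at least `υ` or
at most `υ - g / 2`. The midpoint `υ - g / 4` leaves `g / 4` on each side, and the common factor is
at least `1 / (4a)`. -/
theorem hashing_gap {a b m g u w υ : ℝ} {e W : ℕ} (ha : 1 ≤ a) (hm : 1 ≤ m) (hg : 0 < g)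
    (hbm : b ≤ g * m) (hu0 : 0 ≤ u) (hua : u ≤ a) (hw : w = W) (hwb : w ≤ b)
    (he : (e : ℝ) ≤ a) :
    (υ + g / 2 ≤ u → (m / (2 * a * m) * (1 - m / (2 * a * m)) ^ e) * (υ - g / 4) + g / (16 * a) ≤
      u * (m / (2 * a * m) * (1 - m / (2 * a * m)) ^ e) * (1 - 1 / (2 * a * m)) ^ W) ∧
    (u ≤ υ - g / 2 → u * (m / (2 * a * m) * (1 - m / (2 * a * m)) ^ e) *
      (1 - 1 / (2 * a * m)) ^ W ≤
        (m / (2 * a * m) * (1 - m / (2 * a * m)) ^ e) * (υ - g / 4) - g / (16 * a)) := by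
  have hp : m / (2 * a * m) = 1 / (2 * a) := by field_simp
  rw [hp]
  set p : ℝ := 1 / (2 * a) with hpdef
  set q : ℝ := 1 / (2 * a * m) with hqdef
  have hp0 : 0 < p := by positivity
  have hpa : p * a = 1 / 2 := by rw [hpdef]; field_simp
  have hp1 : p ≤ 1 / 2 := by nlinarith
  have hq0 : 0 < q := by positivity
  have hqam : q * a * m = 1 / 2 := by rw [hqdef]; field_simp
  have hq1 : q ≤ 1 / 2 := by nlinarith [mul_le_mul ha hm zero_le_one (by linarith)]
  have hpe : 1 / 2 ≤ (1 - p) ^ e := by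
    have h1 := one_add_mul_le_pow (a := -p) (by linarith) e
    rw [← sub_eq_add_neg] at h1
    nlinarith
  set K : ℝ := p * (1 - p) ^ e with hK
  have hKp : p / 2 ≤ K := by rw [hK]; nlinarith
  have hK0 : 0 < K := by linarith
  have hδ : g / (16 * a) ≤ K * (g / 4) := by
    have : g / (16 * a) = p / 2 * (g / 4) := by rw [hpdef]; field_simp; norm_num
    rw [this]
    gcongr
  have hW1 : (1 - q) ^ W ≤ 1 := pow_le_one₀ (by linarith) (by linarith)
  have hW2 : 1 - q * b ≤ (1 - q) ^ W := by
    have h1 := one_add_mul_le_pow (a := -q) (by linarith) W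
    rw [← sub_eq_add_neg, ← hw] at h1
    nlinarith
  have hqb : u * (q * b) ≤ g / 2 := by
    have h1 : q * b ≤ q * (g * m) := by gcongr
    calc u * (q * b) ≤ u * (q * (g * m)) := by gcongr
      _ ≤ a * (q * (g * m)) := by gcongr
      _ = (q * a * m) * g := by ring
      _ = g / 2 := by rw [hqam]; ring
  constructor
  · intro h
    have h1 : υ ≤ u * (1 - q) ^ W := by nlinarith [mul_le_mul_of_nonneg_left hW2 hu0]
    nlinarith [mul_le_mul_of_nonneg_left h1 hK0.le]
  · intro h
    have h1 : u * (1 - q) ^ W ≤ υ - g / 2 := by nlinarith [mul_le_mul_of_nonneg_left hW1 hu0]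
    nlinarith [mul_le_mul_of_nonneg_left h1 hK0.le]

/-- The hashing protocol for strings of weights `a` and `b`. -/
theorem randCC_GHD_le_hashing {n a b g : ℕ} {c : ℤ} (hg : 0 < g) (hga : g ≤ a) (hab : a ≤ b) :
    randCC (GHD n a b c g) ≤
      Nat.clog 2 (⌈(b : ℝ) / g⌉₊ + 1) * ⌈768 * ((a : ℝ) / g) ^ 2⌉₊ + 1 := by
  have hg0 : (0 : ℝ) < g := by exact_mod_cast hg
  have ha1 : (1 : ℝ) ≤ a := by exact_mod_cast hg.trans_le hga
  have hb0 : (0 : ℝ) < b := by exact_mod_cast (hg.trans_le hga).trans_le hab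
  set m : ℕ := ⌈(b : ℝ) / g⌉₊ with hm
  have hm0 : 0 < m := Nat.ceil_pos.mpr (by positivity)
  have hm1 : (1 : ℝ) ≤ m := by exact_mod_cast hm0
  have hbm : (b : ℝ) ≤ g * m := by
    rw [mul_comm, ← div_le_iff₀ hg0]
    exact Nat.le_ceil _
  have hN : 0 < 2 * a * m := by have := hg.trans_le hga; positivity
  have hmN : m ≤ 2 * a * m := Nat.le_mul_of_pos_left m (by omega)
  have : NeZero (2 * a * m) := ⟨hN.ne'⟩
  have hδ : (g : ℝ) / (16 * a) = 1 / (16 * (a / g)) := by field_simp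
  have hk : 3 ≤ (⌈768 * ((a : ℝ) / g) ^ 2⌉₊ : ℝ) * ((g : ℝ) / (16 * a)) ^ 2 := by
    have := Nat.le_ceil (768 * ((a : ℝ) / g) ^ 2)
    calc (3 : ℝ) = 768 * ((a : ℝ) / g) ^ 2 * ((g : ℝ) / (16 * a)) ^ 2 := by
          rw [hδ]; field_simp; norm_num
      _ ≤ _ := by gcongr
  have hstat : ∀ x y : Fin n → Bool, hammingWeight x = a → hammingWeight y = b → _ :=
    fun x y hx hy => by
      have h1 := hammingDist_eq_add x y
      have h2 := hammingWeight_eq_add_left x y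
      have h3 := hammingWeight_eq_add_right x y
      rw [hx] at h2
      rw [hy] at h3
      have h4 : (hammingDist x y : ℝ) + a - b =
          2 * ((Finset.univ.filter fun j => x j = true ∧ y j = false).card : ℝ) := by
        rw [h1, h2, h3]
        push_cast
        ring
      exact And.intro h4 (hashing_gap (a := a) (b := b) (m := m) (g := g)
        (u := (Finset.univ.filter fun j => x j = true ∧ y j = false).card)
        (w := (Finset.univ.filter fun j => x j = false ∧ y j = true).card)
        (υ := (c + a - b) / 2) (e := a - 1) ha1 hm1 hg0 hbm (Nat.cast_nonneg _)
        (by exact_mod_cast (by omega)) rfl (by exact_mod_cast (by omega))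
        (by exact_mod_cast Nat.sub_le a 1))
  refine randCC_le_of_advantage (Ω := Fin n → Fin (2 * a * m)) (M := Option (Fin m)) true
    (Nat.clog 2 (m + 1)) _ (by simpa using Nat.le_pow_clog one_lt_two (m + 1))
    (uniqueLabel m) labelMissed
    ((m / (2 * a * m) * (1 - m / (2 * a * m)) ^ (a - 1)) * ((c + a - b) / 2 - g / 4))
    ((g : ℝ) / (16 * a)) (by positivity) hk ?_ ?_
  · intro x y hxy
    obtain ⟨hx, hy, hd⟩ := (GHD_eq_some_iff (by exact_mod_cast hg) x y true).mp hxy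
    obtain ⟨hu, hst, -⟩ := hstat x y hx hy
    have hd' : (c : ℝ) + g ≤ hammingDist x y := by
      rw [if_pos rfl] at hd
      exact_mod_cast hd
    rw [card_labelMissed hN hmN, hx]
    refine mul_le_mul_of_nonneg_right ?_ (Nat.cast_nonneg _)
    push_cast
    exact hst (by linarith)
  · intro x y hxy
    obtain ⟨hx, hy, hd⟩ := (GHD_eq_some_iff (by exact_mod_cast hg) x y false).mp hxy
    obtain ⟨hu, -, hst⟩ := hstat x y hx hy
    have hd' : (hammingDist x y : ℝ) ≤ c - g := by
      have : (hammingDist x y : ℤ) ≤ c - g := by simpa using hd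
      exact_mod_cast this
    rw [card_labelMissed hN hmN, hx]
    refine mul_le_mul_of_nonneg_right ?_ (Nat.cast_nonneg _)
    push_cast
    exact hst (by linarith)

theorem hashing_cost_le {a b g : ℕ} (hg : 0 < g) (hga : g ≤ a) (hab : a ≤ b) :
    ((Nat.clog 2 (⌈(b : ℝ) / g⌉₊ + 1) * ⌈768 * ((a : ℝ) / g) ^ 2⌉₊ + 1 : ℕ) : ℝ) ≤
      20000 * (((a : ℝ) / g) ^ 2 * Real.logb 2 ((b : ℝ) / g) + 1) := by
  have hg0 : (0 : ℝ) < g := by exact_mod_cast hg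
  have hga' : (g : ℝ) ≤ a := by exact_mod_cast hga
  have hab' : (a : ℝ) ≤ b := by exact_mod_cast hab
  set r : ℝ := (a : ℝ) / g with hr
  set t : ℝ := (b : ℝ) / g with ht
  have hr1 : 1 ≤ r := by rw [hr, le_div_iff₀ hg0]; linarith
  have hrt : r ≤ t := by rw [hr, ht]; gcongr
  have ht1 : 1 ≤ t := hr1.trans hrt
  have hL0 : 0 ≤ Real.logb 2 t := Real.logb_nonneg one_lt_two ht1
  have hs : (Nat.clog 2 (⌈t⌉₊ + 1) : ℝ) ≤ Real.logb 2 t + 3 := by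
    have h1 : ((⌈t⌉₊ + 1 : ℕ) : ℝ) ≤ t * 2 ^ 2 := by
      have := Nat.ceil_lt_add_one (show 0 ≤ t by linarith)
      push_cast
      linarith
    have h2 : Real.logb 2 ((⌈t⌉₊ + 1 : ℕ) : ℝ) ≤ Real.logb 2 t + 2 := by
      calc Real.logb 2 ((⌈t⌉₊ + 1 : ℕ) : ℝ) ≤ Real.logb 2 (t * 2 ^ 2) :=
            Real.logb_le_logb_of_le one_lt_two (by positivity) h1
        _ = _ := by
          rw [Real.logb_mul (by linarith) (by norm_num), Real.logb_pow,
            Real.logb_self_eq_one one_lt_two]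
          norm_num
    have h3 : Nat.clog 2 (⌈t⌉₊ + 1) = ⌈Real.logb 2 ((⌈t⌉₊ + 1 : ℕ) : ℝ)⌉₊ := by
      exact_mod_cast (Real.natCeil_logb_natCast 2 (⌈t⌉₊ + 1)).symm
    rw [h3]
    have h4 : 0 ≤ Real.logb 2 ((⌈t⌉₊ + 1 : ℕ) : ℝ) :=
      Real.logb_nonneg one_lt_two (by push_cast; linarith [Nat.cast_nonneg (α := ℝ) ⌈t⌉₊])
    linarith [Nat.ceil_lt_add_one h4]
  have hk : (⌈768 * r ^ 2⌉₊ : ℝ) ≤ 769 * r ^ 2 := by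
    have := Nat.ceil_lt_add_one (show 0 ≤ 768 * r ^ 2 by positivity)
    nlinarith
  have hprod : (Nat.clog 2 (⌈t⌉₊ + 1) : ℝ) * (⌈768 * r ^ 2⌉₊ : ℝ) ≤
      (Real.logb 2 t + 3) * (769 * r ^ 2) := by gcongr
  push_cast
  refine (add_le_add_left hprod 1).trans ?_
  rcases le_or_gt 2 t with h2 | h2
  · have hL1 : 1 ≤ Real.logb 2 t := by
      rw [Real.le_logb_iff_rpow_le one_lt_two (by linarith)]
      simpa using h2
    nlinarith [mul_le_mul_of_nonneg_left hL1 (sq_nonneg r)]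
  · have hr4 : r ^ 2 ≤ 4 := by nlinarith
    have : 0 ≤ r ^ 2 * Real.logb 2 t := by positivity
    nlinarith

/-! ### The bounds for Gap-Hamming-Distance -/

/-- The first bound is nonnegative even where the logarithm is negative. -/
theorem neg_one_le_sq_mul_logb {r t : ℝ} (hr : 0 < r) (hrt : r ≤ t) :
    -1 ≤ r ^ 2 * Real.logb 2 t := by
  have ht : 0 < t := hr.trans_le hrt
  rcases le_or_gt 1 t with h1 | h1
  · have := Real.logb_nonneg one_lt_two h1
    have : 0 ≤ r ^ 2 * Real.logb 2 t := by positivity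
    linarith
  -- From `1 - 1/t ≤ log t` one gets `t ^ 2 * log t ≥ t ^ 2 - t ≥ -1/4`, which exceeds `-log 2`.
  · have hlog := Real.log_two_gt_d9
    have h2 := Real.one_sub_inv_le_log_of_pos ht
    have h3 : Real.log t ≤ 0 := Real.log_nonpos ht.le h1.le
    have h4 : t ^ 2 * (1 - t⁻¹) = t ^ 2 - t := by field_simp
    have h5 : t ^ 2 - t ≤ t ^ 2 * Real.log t := by
      rw [← h4]
      gcongr
    have h6 : t ^ 2 * Real.log t ≤ r ^ 2 * Real.log t :=
      mul_le_mul_of_nonpos_right (by gcongr) h3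
    rw [Real.logb, ← mul_div_assoc, le_div_iff₀ (by linarith)]
    nlinarith [sq_nonneg (t - 1 / 2)]

theorem randCC_GHD_le_weights {n a b g : ℕ} {c : ℤ} (hg : 0 < g) (hab : a ≤ b) :
    (randCC (GHD n a b c g) : ℝ) ≤ 20000 * (((a : ℝ) / g) ^ 2 *
      (Real.logb 2 ((b : ℝ) / a) + Real.logb 2 ((a : ℝ) / g)) + 1) := by
  have hg0 : (0 : ℝ) < g := by exact_mod_cast hg
  have hgz : (0 : ℤ) < g := by exact_mod_cast hg
  have hlog : ((a : ℝ) / g) ^ 2 * (Real.logb 2 ((b : ℝ) / a) + Real.logb 2 ((a : ℝ) / g)) =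
      ((a : ℝ) / g) ^ 2 * Real.logb 2 ((b : ℝ) / g) := by
    rcases Nat.eq_zero_or_pos a with rfl | ha
    · simp
    · have ha0 : (a : ℝ) ≠ 0 := by exact_mod_cast ha.ne'
      have hb0 : (b : ℝ) ≠ 0 := by exact_mod_cast (ha.trans_le hab).ne'
      rw [← Real.logb_mul (div_ne_zero hb0 ha0) (div_ne_zero ha0 hg0.ne'),
        div_mul_div_cancel₀ ha0]
  rw [hlog]
  rcases le_or_gt g a with hga | hga
  · exact le_trans (by exact_mod_cast randCC_GHD_le_hashing hg hga hab)
      (hashing_cost_le hg hga hab)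
  · have hnn : 0 ≤ ((a : ℝ) / g) ^ 2 * Real.logb 2 ((b : ℝ) / g) + 1 := by
      rcases Nat.eq_zero_or_pos a with rfl | ha
      · simp
      · have ha0 : (0 : ℝ) < a := by exact_mod_cast ha
        have := neg_one_le_sq_mul_logb (div_pos ha0 hg0)
          (show (a : ℝ) / g ≤ b / g by gcongr)
        linarith
    -- The distance lies in `[b - a, b + a]`, an interval of length `2a < 2g`, so it cannot reach
    -- both `c - g` and `c + g`.
    have hzero : randCC (GHD n a b c g) = 0 := by
      refine randCC_eq_zero_of_const (decide (c - g < (b : ℤ) - a)) fun x y z hz => ?_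
      obtain ⟨hx, hy, hd⟩ := (GHD_eq_some_iff hgz x y z).mp hz
      have h1 := hammingDist_eq_add x y
      have h2 := hammingWeight_eq_add_left x y
      have h3 := hammingWeight_eq_add_right x y
      cases z
      · simp only [Bool.false_eq_true, if_false] at hd
        symm
        rw [decide_eq_false_iff_not]
        omega
      · simp only [if_true] at hd
        symm
        rw [decide_eq_true_iff]
        omega
    rw [hzero, Nat.cast_zero]
    positivity

theorem hammingDist_not_right {n : ℕ} (x y : Fin n → Bool) :
    hammingDist x (fun i => !y i) + hammingDist x y = n := by
  have h := Finset.card_filter_add_card_filter_not (s := (Finset.univ : Finset (Fin n)))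
    (fun i => x i = y i)
  have h1 : ∀ i, (x i ≠ !y i) = (x i = y i) := fun i => by
    cases x i <;> cases y i <;> simp
  rw [Finset.card_univ, Fintype.card_fin] at h
  simpa [hammingDist, h1] using h

theorem randCC_GHD_le_sq_div {n a b g : ℕ} {c : ℤ} (hg : 0 < g) :
    (randCC (GHD n a b c g) : ℝ) ≤ 800 * ((c : ℝ) / g) ^ 2 := by
  have hgz : (0 : ℤ) < g := by exact_mod_cast hg
  rcases le_or_gt (g : ℤ) c with hgc | hgc
  · lift c to ℕ using by omega
    have hgc' : g ≤ c := by exact_mod_cast hgc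
    refine le_of_le_of_eq (randCC_le_of_hammingDist_gap true id hg hgc' (fun x y hxy => ?_)
      fun x y hxy => ?_) (by simp)
    · have hd := ((GHD_eq_some_iff hgz x y true).mp hxy).2.2
      simp only [if_true] at hd
      exact_mod_cast hd
    · have hd := ((GHD_eq_some_iff hgz x y false).mp hxy).2.2
      simp only [Bool.false_eq_true, if_false, id] at hd ⊢
      omega
  · rw [randCC_eq_zero_of_const true fun x y z hz => ?_, Nat.cast_zero]
    · positivity
    · have hd := ((GHD_eq_some_iff hgz x y z).mp hz).2.2
      cases z
      · simp only [Bool.false_eq_true, if_false] at hd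
        omega
      · rfl

/-- Complementing `y` puts the gap around `n - c` and swaps the roles of the two values, hence `σ =
false`. If `n - c < g`, the value `true` would need a distance above `n`. -/
theorem randCC_GHD_le_sq_sub_div {n a b g : ℕ} {c : ℤ} (hg : 0 < g) :
    (randCC (GHD n a b c g) : ℝ) ≤ 800 * (((n : ℝ) - c) / g) ^ 2 := by
  have hgz : (0 : ℤ) < g := by exact_mod_cast hg
  rcases le_or_gt (g : ℤ) (n - c) with hgc | hgc
  · obtain ⟨d, hdc⟩ := Int.eq_ofNat_of_zero_le (show 0 ≤ (n : ℤ) - c by omega)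
    have hgd : g ≤ d := by omega
    have hdr : (n : ℝ) - c = d := by exact_mod_cast hdc
    rw [hdr]
    refine randCC_le_of_hammingDist_gap false (fun y i => !y i) hg hgd (fun x y hxy => ?_)
      fun x y hxy => ?_
    · have hd := ((GHD_eq_some_iff hgz x y false).mp hxy).2.2
      have := hammingDist_not_right x y
      simp only [Bool.false_eq_true, if_false] at hd
      omega
    · have hd := ((GHD_eq_some_iff hgz x y true).mp hxy).2.2
      have := hammingDist_not_right x y
      simp only [if_true] at hd
      omega
  · rw [randCC_eq_zero_of_const false fun x y z hz => ?_, Nat.cast_zero]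
    · positivity
    · have hd := ((GHD_eq_some_iff hgz x y z).mp hz).2.2
      have := hammingDist_not_right x y
      cases z
      · rfl
      · simp only [if_true] at hd
        omega

theorem mainTheorem6 :
    ∃ C : ℝ, 0 < C ∧ ∀ (n a b : ℕ) (c g : ℤ), a ≤ b → 2 * b ≤ n → 0 < g →
      (randCC (GHD n a b c g) : ℝ) ≤
          C * (((a : ℝ) / g) ^ 2 *
            (Real.logb 2 ((b : ℝ) / a) + Real.logb 2 ((a : ℝ) / g)) + 1) ∧
      (randCC (GHD n a b c g) : ℝ) ≤
          C * min (((c : ℝ) / g) ^ 2) ((((n : ℝ) - c) / g) ^ 2) := by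
  refine ⟨20000, by norm_num, fun n a b c g hab _ hg => ?_⟩
  lift g to ℕ using hg.le
  have hg' : 0 < g := by exact_mod_cast hg
  rw [Int.cast_natCast]
  refine ⟨randCC_GHD_le_weights hg' hab, ?_⟩
  rw [mul_min_of_nonneg _ _ (by norm_num)]
  refine le_min ?_ ?_
  · exact (randCC_GHD_le_sq_div hg').trans (by gcongr; norm_num)
  · exact (randCC_GHD_le_sq_sub_div hg').trans (by gcongr; norm_num)
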